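/- **The calculus.** Types are $S,T ::= B \mid \mathsf{E}(T)\mid S\to T$ with $B$ ranging over basic types; $\mathsf E(T)$ is the type of effectful computations with result in $T$. Terms are $s,t,u ::= x\mid \lambda x.u\mid \mathit{pure}(t)\mid st\mid \gamma(t_1,\dots,t_n)\mid \mathsf{let}\ x\Leftarrow t\ \mathsf{in}\ u$, where $\gamma$ is an effect symbol $e$ with a finite arity $n$ or a function symbol $f : S_1\times\cdots\times S_n\to T$. Typing is as usual for $\lambda$-abstraction and application; $\mathit{pure}(t):\mathsf E(T)$ if $t:T$; $\mathsf{let}\ x\Leftarrow t\ \mathsf{in}\ u:\mathsf E(T)$ if $t:\mathsf E(S)$ and $u:\mathsf E(T)$ under $x:S$; $e(t_1,\dots,t_n):\mathsf E(T)$ if all $t_i:\mathsf E(T)$; $f(t_1,\dots,t_n):T$ if $t_i:S_i$ for each $i$. The metalanguage rules $\leadsto_{ml}$ are $$(\lambda x.u)\,t\leadsto_{ml} u\{t/x\},\qquad \mathsf{let}\ x\Leftarrow \mathit{pure}(t)\ \mathsf{in}\ u\leadsto_{ml} u\{t/x\},$$ $$\mathsf{let}\ y\Leftarrow(\mathsf{let}\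 x\Leftarrow t_1\ \mathsf{in}\ t_2)\ \mathsf{in}\ u\leadsto_{ml}\mathsf{let}\ x\Leftarrow t_1\ \mathsf{in}\ \mathsf{let}\ y\Leftarrow t_2\ \mathsf{in}\ u\quad(x\notin FV(u)),$$ $$\mathsf{let}\ x\Leftarrow e(t_1,\dots,t_n)\ \mathsf{in}\ u\leadsto_{ml} e(\mathsf{let}\ x\Leftarrow t_1\ \mathsf{in}\ u,\dots,\mathsf{let}\ x\Leftarrow t_n\ \mathsf{in}\ u)\quad(e\text{ an effect symbol}).$$ All rewrite rules may be applied in any term context. **The RPO.** Let $>$ be a well-founded strict order on the symbols. The recursive path ordering $\succ$ is defined inductively: for $s=\gamma(s_1,\dots,s_m)$, $s\succ t$ if (1) $t=\gamma(t_1,\dots,t_m)$, $\vec s\succ_{lex}\vec t$, and $s\succ t_j$ for all $j$; or (2) $t=\gamma'(t_1,\dots,t_n)$, $\gamma>\gamma'$, and $s\succ t_j$ for all $j$; or (3) $s_i=t$ or $s_i\succ t$ for some $i$. In each of the systems below the effect symbols are exactly the ones listed, and there may be any further function symbols, which have no rewrite rules of their own. **Theorem.** 1. *Global state* (a cell with $n$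 possible values, $n\ge 0$). The effect symbols are $assign_i$ ($1\le i\le n$) of arity $1$ and $get$ of arity $n$, with the rules $$assign_i(get(t_1,\dots,t_n))\leadsto assign_i(t_i),\qquad assign_i(assign_j(s))\leadsto assign_j(s),$$ $$get(t_1,\dots,t_i,\dots,t_n)\leadsto get(t_1,\dots,s_i,\dots,t_n)\quad\text{where } t_i=get(s_1,\dots,s_n).$$ (a) For every order $>$ on the symbols, these rules are contained in $\succ$. (b) Every well-typed term is strongly normalizing under $(\leadsto)\cup(\leadsto_{ml})$. (c) Traces reduce to states. Call a term a *trace* if it is built by $assign_i$ and $get$ from leaves of the form $\mathit{pure}(v)$. Call it an *outcome* if it is $\mathit{pure}(v)$ or $assign_i(\mathit{pure}(v))$, and a *state* if it is an outcome or $get(o_1,\dots,o_n)$ with all $o_j$ outcomes. Then every well-typed trace reduces under $(\leadsto)\cup(\leadsto_{ml})$ to a normal form, and each of its normal forms is a state. 2. *Nondeterminism.* The only effect symbol is $or$, of arity $2$, with the rule $or(or(s_1,s_2),s_3)\leadsto or(s_1,or(s_2,s_3))$. For every order $>$ the rule is contained in $\succ$, and every well-typed term is strongly normalizing under $(\leadsto)\cup(\leadsto_{ml})$.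 3. *Parallelism.* The effect symbols are $par$, of arity $2$, and arbitrary other effect symbols $e$ of finite arities, with, for every such $e$, the rules $$par(e(s_1,\dots,s_n),t)\leadsto e(par(s_1,t),\dots,par(s_n,t)),\qquad par(s,e(t_1,\dots,t_n))\leadsto e(par(s,t_1),\dots,par(s,t_n)).$$ There is an order $>$ with $par>e$ for all these $e$; for every such order the rules are contained in $\succ$; and every well-typed term is strongly normalizing under $(\leadsto)\cup(\leadsto_{ml})$. 4. *Request-retry.* The effect symbols are $zero$, $succ$, $retry$, $request$, of arities $0$, $1$, $2$, $n+1$ ($n\ge0$), with the rules $$retry(zero(),request(t,s_1,\dots,s_n))\leadsto t,$$ $$retry(succ(u),request(t,s_1,\dots,s_n))\leadsto request(retry(u,request(t,s_1,\dots,s_n)),s_1,\dots,s_n).$$ There is an order $>$ with $retry>request$; for every such order the rules are contained in $\succ$; and every well-typed term is strongly normalizing under $(\leadsto)\cup(\leadsto_{ml})$. -/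

import Mathlib

universe u v w

namespace AlgEff

/-- Types of the metalanguage: basic types, computation types `E(T)`, function types `S → T`. -/
inductive Ty (B : Type u) : Type u
  | base (b : B) : Ty B
  | comp (T : Ty B) : Ty B
  | arrow (S T : Ty B) : Ty B

/-- A collection of function symbols `f`, each with a signature `S₁ × ⋯ × Sₙ → T`. -/
structure FunctionSymbols (B : Type u) where
  Fn : Type w
  arity : Fn → ℕ
  dom : (f : Fn) → Fin (arity f) → Ty B
  cod : Fn → Ty B

/-- A signature: effect symbols with their arities, and function symbols with their types. -/
structure Signature (B : Type u) where
  Eff : Type v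
  effArity : Eff → ℕ
  fns : FunctionSymbols.{u, w} B

/-- Rewritable symbols `γ`: effect symbols (`Sum.inl e`) and function symbols (`Sum.inr f`). -/
abbrev Signature.Symbol {B : Type u} (S : Signature.{u, v, w} B) : Type (max v w) :=
  S.Eff ⊕ S.fns.Fn

/-- The number of arguments of a rewritable symbol. -/
@[reducible] def Signature.arity {B : Type u} (S : Signature.{u, v, w} B) : S.Symbol → ℕ
  | Sum.inl e => S.effArity e
  | Sum.inr f => S.fns.arity f

/-- Terms `x ∣ λx.u ∣ pure(t) ∣ s t ∣ γ(t₁,…,tₙ) ∣ let x ⇐ t in u`, modulo renaming of bound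
variables: variables are de Bruijn indices, `lam u` and `letIn t u` bind the index `0` in `u`. -/
inductive Term {B : Type u} (S : Signature.{u, v, w} B) : Type (max v w)
  | var (k : ℕ) : Term S
  | lam (u : Term S) : Term S
  | pure (t : Term S) : Term S
  | app (s t : Term S) : Term S
  | sym (γ : S.Symbol) (ts : Fin (S.arity γ) → Term S) : Term S
  | letIn (t u : Term S) : Term S

section Substitution

variable {B : Type u} {S : Signature.{u, v, w} B}

/-- Extension of a renaming under one binder. -/
def liftRen (ρ : ℕ → ℕ) : ℕ → ℕ
  | 0 => 0
  | k + 1 => ρ k + 1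

/-- Capture-avoiding renaming of the free variables. -/
def Term.rename : (ℕ → ℕ) → Term S → Term S
  | ρ, .var k => .var (ρ k)
  | ρ, .lam u => .lam (u.rename (liftRen ρ))
  | ρ, .pure t => .pure (t.rename ρ)
  | ρ, .app s t => .app (s.rename ρ) (t.rename ρ)
  | ρ, .sym γ ts => .sym γ (fun i => (ts i).rename ρ)
  | ρ, .letIn t u => .letIn (t.rename ρ) (u.rename (liftRen ρ))

/-- Extension of a substitution under one binder. -/
def liftSubst (σ : ℕ → Term S) : ℕ → Term S
  | 0 => .var 0
  | k + 1 => (σ k).rename Nat.succ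

/-- Capture-avoiding simultaneous substitution. -/
def Term.subst : (ℕ → Term S) → Term S → Term S
  | σ, .var k => σ k
  | σ, .lam u => .lam (u.subst (liftSubst σ))
  | σ, .pure t => .pure (t.subst σ)
  | σ, .app s t => .app (s.subst σ) (t.subst σ)
  | σ, .sym γ ts => .sym γ (fun i => (ts i).subst σ)
  | σ, .letIn t u => .letIn (t.subst σ) (u.subst (liftSubst σ))

/-- The substitution that replaces the variable `0` by `t` and lowers all other variables. -/
def instVar (t : Term S) : ℕ → Term S
  | 0 => t
  | k + 1 => .var k

/-- `u.inst t` is `u{t/x}`, where `x` is the variable with index `0`. -/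
def Term.inst (u t : Term S) : Term S := u.subst (instVar t)

end Substitution

section Calculus

variable {B : Type u} {S : Signature.{u, v, w} B}

/-- The typing judgement `Γ ⊢ t : T`. -/
inductive HasType : List (Ty B) → Term S → Ty B → Prop
  | var {Γ : List (Ty B)} {k : ℕ} {T : Ty B} (h : Γ[k]? = some T) : HasType Γ (.var k) T
  | lam {Γ : List (Ty B)} {u : Term S} {A T : Ty B} (h : HasType (A :: Γ) u T) :
      HasType Γ (.lam u) (.arrow A T)
  | app {Γ : List (Ty B)} {s t : Term S} {A T : Ty B} (hs : HasType Γ s (.arrow A T))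
      (ht : HasType Γ t A) : HasType Γ (.app s t) T
  | letIn {Γ : List (Ty B)} {t u : Term S} {A T : Ty B} (ht : HasType Γ t (.comp A))
      (hu : HasType (A :: Γ) u (.comp T)) : HasType Γ (.letIn t u) (.comp T)
  | pure {Γ : List (Ty B)} {t : Term S} {T : Ty B} (h : HasType Γ t T) :
      HasType Γ (.pure t) (.comp T)
  | eff {Γ : List (Ty B)} (e : S.Eff) (ts : Fin (S.effArity e) → Term S) {T : Ty B}
      (h : ∀ i, HasType Γ (ts i) (.comp T)) : HasType Γ (.sym (Sum.inl e) ts) (.comp T)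
  | fn {Γ : List (Ty B)} (f : S.fns.Fn) (ts : Fin (S.fns.arity f) → Term S)
      (h : ∀ i, HasType Γ (ts i) (S.fns.dom f i)) :
      HasType Γ (.sym (Sum.inr f) ts) (S.fns.cod f)

/-- The rewrite rules of the metalanguage (at the root of a term). In `letAssoc` the renaming
makes room for the variable `x` bound by the outer `let`, so that `x` is not free in the moved
copy of `u`. -/
inductive MLRule : Term S → Term S → Prop
  | beta (u t : Term S) : MLRule (.app (.lam u) t) (u.inst t)
  | letBeta (t u : Term S) : MLRule (.letIn (.pure t) u) (u.inst t)
  | letAssoc (t₁ t₂ u : Term S) :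
      MLRule (.letIn (.letIn t₁ t₂) u)
        (.letIn t₁ (.letIn t₂ (u.rename (liftRen Nat.succ))))
  | effAssoc (e : S.Eff) (ts : Fin (S.effArity e) → Term S) (u : Term S) :
      MLRule (.letIn (.sym (Sum.inl e) ts) u)
        (.sym (Sum.inl e) (fun i => .letIn (ts i) u))

/-- The compatible closure of a relation: one rewrite at an arbitrary position in a term. -/
inductive Compat (R : Term S → Term S → Prop) : Term S → Term S → Prop
  | root {s t : Term S} (h : R s t) : Compat R s t
  | lam {u u' : Term S} (h : Compat R u u') : Compat R (.lam u) (.lam u')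
  | pure {t t' : Term S} (h : Compat R t t') : Compat R (.pure t) (.pure t')
  | appL {s s' t : Term S} (h : Compat R s s') : Compat R (.app s t) (.app s' t)
  | appR {s t t' : Term S} (h : Compat R t t') : Compat R (.app s t) (.app s t')
  | sym (γ : S.Symbol) (ts : Fin (S.arity γ) → Term S) (i : Fin (S.arity γ)) {t' : Term S}
      (h : Compat R (ts i) t') : Compat R (.sym γ ts) (.sym γ (Function.update ts i t'))
  | letL {t t' u : Term S} (h : Compat R t t') : Compat R (.letIn t u) (.letIn t' u)
  | letR {t u u' : Term S} (h : Compat R u u') : Compat R (.letIn t u) (.letIn t u')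

/-- One step of the calculus with the symbol rewrite rules `R` and the metalanguage rules, in any
context. -/
def Step (R : Term S → Term S → Prop) : Term S → Term S → Prop :=
  Compat (fun s t => R s t ∨ MLRule s t)

/-- Every reduction sequence `t → t₁ → t₂ → ⋯` is finite. -/
def SN (step : Term S → Term S → Prop) (t : Term S) : Prop :=
  Acc (fun b a => step a b) t

/-- No reduction step is possible. -/
def IsNormal (step : Term S → Term S → Prop) (t : Term S) : Prop :=
  ∀ t', ¬ step t t'

/-- A symbol ordering `>` for the recursive path ordering: a well-founded strict order, with
`gt γ γ'` meaning `γ > γ'`. -/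
structure IsPrecedence (gt : S.Symbol → S.Symbol → Prop) : Prop where
  strict : IsStrictOrder S.Symbol gt
  wf : WellFounded (fun a b => gt b a)

/-- The recursive path ordering `s ≻ t` for the symbol ordering `gt`. In `lex` the argument
sequences are compared lexicographically, the first difference being at position `k`. The rule
"`sᵢ ≽ t` for some `i`" is split into the cases `sᵢ = t` and `sᵢ ≻ t`. -/
inductive RPO (gt : S.Symbol → S.Symbol → Prop) : Term S → Term S → Prop
  | lex (γ : S.Symbol) (ss ts : Fin (S.arity γ) → Term S) (k : Fin (S.arity γ))
      (heq : ∀ j, j < k → ss j = ts j) (hk : RPO gt (ss k) (ts k))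
      (h : ∀ j, RPO gt (.sym γ ss) (ts j)) : RPO gt (.sym γ ss) (.sym γ ts)
  | prec (γ γ' : S.Symbol) (ss : Fin (S.arity γ) → Term S) (ts : Fin (S.arity γ') → Term S)
      (hgt : gt γ γ') (h : ∀ j, RPO gt (.sym γ ss) (ts j)) : RPO gt (.sym γ ss) (.sym γ' ts)
  | argEq (γ : S.Symbol) (ss : Fin (S.arity γ) → Term S) (i : Fin (S.arity γ)) :
      RPO gt (.sym γ ss) (ss i)
  | argGt (γ : S.Symbol) (ss : Fin (S.arity γ) → Term S) (i : Fin (S.arity γ)) {t : Term S}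
      (h : RPO gt (ss i) t) : RPO gt (.sym γ ss) t

/-- The rewrite rules `R` are contained in the recursive path ordering for `gt`. -/
def ContainedInRPO (gt : S.Symbol → S.Symbol → Prop) (R : Term S → Term S → Prop) : Prop :=
  ∀ l r, R l r → RPO gt l r

/-- All well-typed terms are strongly normalizing under the rules `R` together with the
metalanguage rules. -/
def TypedSN (R : Term S → Term S → Prop) : Prop :=
  ∀ (Γ : List (Ty B)) (t : Term S) (T : Ty B), HasType Γ t T → SN (Step R) t

end Calculus

/-! ### Global state: one cell holding one of `n` values -/

namespace GlobalState

inductive Eff (n : ℕ) : Type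
  | assign (i : Fin n) : Eff n
  | get : Eff n

/-- `assign_i` has arity one; the arguments of `get` are indexed by the `n` storable values. -/
@[reducible] def sig {B : Type u} (F : FunctionSymbols.{u, w} B) (n : ℕ) :
    Signature.{u, 0, w} B where
  Eff := Eff n
  effArity
    | .assign _ => 1
    | .get => n
  fns := F

variable {B : Type u} {F : FunctionSymbols.{u, w} B} {n : ℕ}

def assign (i : Fin n) (t : Term (sig F n)) : Term (sig F n) :=
  .sym (Sum.inl (Eff.assign i)) (fun _ => t)

def get (ts : Fin n → Term (sig F n)) : Term (sig F n) :=
  .sym (Sum.inl Eff.get) ts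

/-- Instances of the global-state rewrite rules. -/
inductive Rule : Term (sig F n) → Term (sig F n) → Prop
  | assignGet (i : Fin n) (ts : Fin n → Term (sig F n)) :
      Rule (assign i (get ts)) (assign i (ts i))
  | assignAssign (i j : Fin n) (s : Term (sig F n)) :
      Rule (assign i (assign j s)) (assign j s)
  | getGet (ts : Fin n → Term (sig F n)) (i : Fin n) (ss : Fin n → Term (sig F n))
      (h : ts i = get ss) : Rule (get ts) (get (Function.update ts i (ss i)))

/-- Traces: trees of global-state effects whose leaves return values. -/
inductive IsTrace : Term (sig F n) → Prop
  | pure (v : Term (sig F n)) : IsTrace (.pure v)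
  | assign (i : Fin n) (t : Term (sig F n)) (h : IsTrace t) : IsTrace (assign i t)
  | get (ts : Fin n → Term (sig F n)) (h : ∀ j, IsTrace (ts j)) : IsTrace (get ts)

/-- A returned value, possibly preceded by one final assignment. -/
inductive IsOutcome : Term (sig F n) → Prop
  | pure (v : Term (sig F n)) : IsOutcome (.pure v)
  | assign (i : Fin n) (v : Term (sig F n)) : IsOutcome (assign i (.pure v))

/-- States: an outcome, or a single read of the initial value of the cell, with one outcome for
each value read. -/
inductive IsState : Term (sig F n) → Prop
  | outcome (t : Term (sig F n)) (h : IsOutcome t) : IsState t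
  | get (ts : Fin n → Term (sig F n)) (h : ∀ j, IsOutcome (ts j)) : IsState (get ts)

end GlobalState

/-! ### Nondeterminism -/

namespace Nondet

inductive Eff : Type
  | or : Eff

@[reducible] def sig {B : Type u} (F : FunctionSymbols.{u, w} B) : Signature.{u, 0, w} B where
  Eff := Eff
  effArity
    | .or => 2
  fns := F

variable {B : Type u} {F : FunctionSymbols.{u, w} B}

def or (s t : Term (sig F)) : Term (sig F) :=
  .sym (Sum.inl Eff.or) ![s, t]

/-- Instances of the rewrite rule for nondeterminism. -/
inductive Rule : Term (sig F) → Term (sig F) → Prop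
  | assoc (s₁ s₂ s₃ : Term (sig F)) : Rule (or (or s₁ s₂) s₃) (or s₁ (or s₂ s₃))

end Nondet

/-! ### Parallelism, on top of arbitrary other effect symbols `E` with arities `ar` -/

namespace Parallel

inductive Eff (E : Type v) : Type v
  | par : Eff E
  | other (e : E) : Eff E

@[reducible] def sig {B : Type u} (F : FunctionSymbols.{u, w} B) (E : Type v) (ar : E → ℕ) :
    Signature.{u, v, w} B where
  Eff := Eff E
  effArity
    | .par => 2
    | .other e => ar e
  fns := F

variable {B : Type u} {F : FunctionSymbols.{u, w} B} {E : Type v} {ar : E → ℕ}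

def par (s t : Term (sig F E ar)) : Term (sig F E ar) :=
  .sym (Sum.inl Eff.par) ![s, t]

def other (e : E) (ts : Fin (ar e) → Term (sig F E ar)) : Term (sig F E ar) :=
  .sym (Sum.inl (Eff.other e)) ts

/-- Instances of the rewrite rules for parallelism. -/
inductive Rule : Term (sig F E ar) → Term (sig F E ar) → Prop
  | left (e : E) (ss : Fin (ar e) → Term (sig F E ar)) (t : Term (sig F E ar)) :
      Rule (par (other e ss) t) (other e (fun i => par (ss i) t))
  | right (e : E) (s : Term (sig F E ar)) (ts : Fin (ar e) → Term (sig F E ar)) :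
      Rule (par s (other e ts)) (other e (fun i => par s (ts i)))

end Parallel

/-! ### Request-retry, where a successful request returns one of `n` values -/

namespace RequestRetry

inductive Eff : Type
  | zero : Eff
  | succ : Eff
  | request : Eff
  | retry : Eff

@[reducible] def sig {B : Type u} (F : FunctionSymbols.{u, w} B) (n : ℕ) :
    Signature.{u, 0, w} B where
  Eff := Eff
  effArity
    | .zero => 0
    | .succ => 1
    | .request => n + 1
    | .retry => 2
  fns := F

variable {B : Type u} {F : FunctionSymbols.{u, w} B} {n : ℕ}

def zero : Term (sig F n) :=
  .sym (Sum.inl Eff.zero) ![]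

def succ (u : Term (sig F n)) : Term (sig F n) :=
  .sym (Sum.inl Eff.succ) ![u]

/-- `request(t, s₁, …, sₙ)`: continue with `t` on failure, with `sᵢ` on the `i`-th result. -/
def request (t : Term (sig F n)) (ss : Fin n → Term (sig F n)) : Term (sig F n) :=
  .sym (Sum.inl Eff.request) (Fin.cons t ss : Fin (n + 1) → Term (sig F n))

def retry (u r : Term (sig F n)) : Term (sig F n) :=
  .sym (Sum.inl Eff.retry) ![u, r]

/-- Instances of the rewrite rules for request-retry. -/
inductive Rule : Term (sig F n) → Term (sig F n) → Prop
  | retryZero (t : Term (sig F n)) (ss : Fin n → Term (sig F n)) :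
      Rule (retry zero (request t ss)) t
  | retrySucc (u t : Term (sig F n)) (ss : Fin n → Term (sig F n)) :
      Rule (retry (succ u) (request t ss)) (request (retry u (request t ss)) ss)

end RequestRetry

end AlgEff

open AlgEff

/-! Termination is proved by reducibility, with biorthogonality at computation types. A continuation
is a stack `K` of `let` bodies, and `t` is reducible at `E(T)` if `plug K t` terminates for every
`K` such that `plug K (pure v)` terminates for all reducible `v`. The cases of abstraction, `let`
and function symbols then work for any rules that are headed by effect symbols, with stability under
substitution for the two binders (`EffHeaded.red`, `EffHeaded.red_beta`, `SN.plug_letBeta`).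

What depends on the effect rules is concentrated in `EffectRules.sn_plug_eff`: `plug K (e(ts))`
terminates if `K` and all `plug K (ts i)` do. This is the termination argument for a recursive path
ordering, carried out underneath a continuation: induction on `e`, then lexicographically on the
tuple of the `plug K (ts i)`, then on the length of `K`, then on `K` itself. Entries descend by
reduction and by passing to arguments of effects; the latter survives under `K` because `K` can be
pushed inside the effect (`ArgOf.descent_plug`). `Below` isolates the fragment of the ordering that
this needs. Each system verifies it in `rule_below`; containment in the full `RPO` is checked
separately.

For traces, reduction stays among traces, and a normal trace is a state because an `assign` above
`assign` or `get`, and a `get` above `get`, are redexes. -/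

namespace AlgEff

/-! ### De Bruijn substitution calculus. -/

section SubstitutionLemmas

variable {B : Type u} {S : Signature.{u, v, w} B}

theorem liftSubst_var : liftSubst (Term.var : ℕ → Term S) = Term.var := by
  funext k; cases k <;> rfl

theorem Term.subst_var (t : Term S) : t.subst Term.var = t := by
  induction t <;> simp_all [Term.subst, liftSubst_var]

theorem liftSubst_comp_liftRen (ρ : ℕ → ℕ) (σ : ℕ → Term S) :
    (fun k => liftSubst σ (liftRen ρ k)) = liftSubst (fun k => σ (ρ k)) := by
  funext k; cases k <;> rfl

theorem Term.subst_of_rename (t : Term S) (ρ : ℕ → ℕ) (σ : ℕ → Term S) :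
    (t.rename ρ).subst σ = t.subst (fun k => σ (ρ k)) := by
  induction t generalizing ρ σ <;>
    simp_all [Term.subst, Term.rename, liftSubst_comp_liftRen]

theorem liftSubst_var_comp (ρ : ℕ → ℕ) :
    liftSubst (fun k => (Term.var (ρ k) : Term S)) = fun k => Term.var (liftRen ρ k) := by
  funext k; cases k <;> rfl

theorem Term.rename_eq_subst (t : Term S) (ρ : ℕ → ℕ) :
    t.rename ρ = t.subst (fun k => .var (ρ k)) := by
  induction t generalizing ρ <;>
    simp_all [Term.subst, Term.rename, liftSubst_var_comp]

theorem Term.rename_rename (t : Term S) (ρ ρ' : ℕ → ℕ) :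
    (t.rename ρ).rename ρ' = t.rename (fun k => ρ' (ρ k)) := by
  rw [Term.rename_eq_subst _ ρ', Term.subst_of_rename, ← Term.rename_eq_subst]

theorem liftSubst_rename (ρ : ℕ → ℕ) (σ : ℕ → Term S) :
    (fun k => (liftSubst σ k).rename (liftRen ρ)) = liftSubst (fun k => (σ k).rename ρ) := by
  funext k
  cases k with
  | zero => rfl
  | succ k => simp only [liftSubst, Term.rename_rename, liftRen]

theorem Term.rename_of_subst (t : Term S) (σ : ℕ → Term S) (ρ : ℕ → ℕ) :
    (t.subst σ).rename ρ = t.subst (fun k => (σ k).rename ρ) := by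
  induction t generalizing ρ σ <;>
    simp_all [Term.subst, Term.rename, liftSubst_rename]

theorem liftSubst_subst (σ τ : ℕ → Term S) :
    (fun k => (liftSubst σ k).subst (liftSubst τ)) = liftSubst (fun k => (σ k).subst τ) := by
  funext k
  cases k with
  | zero => rfl
  | succ k => simp only [liftSubst, Term.subst_of_rename, Term.rename_of_subst]

/-- Lifting a substitution under a binder renames its values, so the two mixed laws for renaming and
substitution have to come before this one. -/
theorem Term.subst_subst (t : Term S) (σ τ : ℕ → Term S) :
    (t.subst σ).subst τ = t.subst (fun k => (σ k).subst τ) := by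
  induction t generalizing σ τ <;> simp_all [Term.subst, liftSubst_subst]

theorem Term.subst_inst (u t : Term S) (σ : ℕ → Term S) :
    (u.inst t).subst σ = (u.subst (liftSubst σ)).inst (t.subst σ) := by
  simp only [Term.inst, Term.subst_subst]
  congr 1
  funext k
  cases k with
  | zero => rfl
  | succ k =>
    simp only [instVar, liftSubst, Term.subst_of_rename, Term.subst]
    exact (Term.subst_var _).symm

theorem Term.rename_liftRen_succ_subst (u : Term S) (σ : ℕ → Term S) :
    (u.rename (liftRen Nat.succ)).subst (liftSubst (liftSubst σ)) =
      (u.subst (liftSubst σ)).rename (liftRen Nat.succ) := by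
  simp only [Term.subst_of_rename, Term.rename_of_subst]
  congr 1
  funext k
  cases k with
  | zero => rfl
  | succ k => simp only [liftSubst, liftRen, Term.rename_rename]

/-- Instantiating the inner variable of `let y ⇐ t₂ in u` when `x` is not free in `u`. -/
theorem Term.rename_liftRen_succ_subst_instVar (u v : Term S) :
    (u.rename (liftRen Nat.succ)).subst (liftSubst (instVar v)) = u := by
  rw [Term.subst_of_rename]
  convert Term.subst_var u using 2
  funext k
  cases k <;> rfl

/-- Substituting and then instantiating the bound variable is a single substitution. -/
theorem Term.inst_of_subst_liftSubst (u v : Term S) (σ : ℕ → Term S) :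
    (u.subst (liftSubst σ)).inst v = u.subst (fun | 0 => v | k + 1 => σ k) := by
  rw [Term.inst, Term.subst_subst]
  congr 1
  funext k
  cases k with
  | zero => rfl
  | succ k =>
    simp only [liftSubst, Term.subst_of_rename]
    exact Term.subst_var _

end SubstitutionLemmas

/-! ### Reduction, substitution and strong normalization. -/

section Reduction

variable {B : Type u} {S : Signature.{u, v, w} B} {R : Term S → Term S → Prop}

/-- A relation on terms that is stable under substitution. -/
def SubstStable (R : Term S → Term S → Prop) : Prop :=
  ∀ (s t : Term S) (σ : ℕ → Term S), R s t → R (s.subst σ) (t.subst σ)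

theorem MLRule.subst {s t : Term S} (h : MLRule s t) (σ : ℕ → Term S) :
    MLRule (s.subst σ) (t.subst σ) := by
  cases h with
  | beta u t => rw [Term.subst_inst]; exact .beta _ _
  | letBeta t u => rw [Term.subst_inst]; exact .letBeta _ _
  | letAssoc t₁ t₂ u =>
    simp only [Term.subst, Term.rename_liftRen_succ_subst]; exact .letAssoc _ _ _
  | effAssoc e ts u => exact .effAssoc e _ _

theorem subst_update {n : ℕ} (ts : Fin n → Term S) (i : Fin n) (t : Term S) (σ : ℕ → Term S) :
    (fun j => (Function.update ts i t j).subst σ) =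
      Function.update (fun j => (ts j).subst σ) i (t.subst σ) := by
  funext j
  exact Function.apply_update (fun _ x => Term.subst σ x) ts i t j

theorem Compat.subst (hR : SubstStable R) {s t : Term S} (h : Compat R s t)
    (σ : ℕ → Term S) : Compat R (s.subst σ) (t.subst σ) := by
  induction h generalizing σ with
  | root h => exact .root (hR _ _ σ h)
  | lam _ ih => exact .lam (ih _)
  | pure _ ih => exact .pure (ih _)
  | appL _ ih => exact .appL (ih _)
  | appR _ ih => exact .appR (ih _)
  | sym γ ts i _ ih =>
    simp only [Term.subst]
    rw [subst_update]
    exact .sym γ (fun j => (ts j).subst σ) i (ih σ)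
  | letL _ ih => exact .letL (ih _)
  | letR _ ih => exact .letR (ih _)

theorem Step.subst (hR : SubstStable R) {s t : Term S} (h : Step R s t) (σ : ℕ → Term S) :
    Step R (s.subst σ) (t.subst σ) :=
  Compat.subst (fun _ _ σ h => h.imp (hR _ _ σ) (fun h => h.subst σ)) h σ

/-- Reduction of all arguments of a symbol, one after the other. -/
theorem reflTransGen_sym (γ : S.Symbol) (ts ts' : Fin (S.arity γ) → Term S)
    (h : ∀ i, Relation.ReflTransGen (Step R) (ts i) (ts' i)) :
    Relation.ReflTransGen (Step R) (.sym γ ts) (.sym γ ts') := by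
  have single : ∀ (rs : Fin (S.arity γ) → Term S) (i : Fin (S.arity γ)) (t : Term S),
      Relation.ReflTransGen (Step R) (rs i) t →
        Relation.ReflTransGen (Step R) (.sym γ rs) (.sym γ (Function.update rs i t)) := by
    intro rs i t h
    induction h with
    | refl => rw [Function.update_eq_self]
    | @tail b c _ hbc ih =>
      refine ih.tail ?_
      have := Compat.sym (R := fun s t => R s t ∨ MLRule s t) γ (Function.update rs i b) i
        (t' := c) (by rw [Function.update_self]; exact hbc)
      rwa [Function.update_idem] at this
  -- The arguments with index in `s` have been reduced already, the others not yet.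
  have key : ∀ s : Finset (Fin (S.arity γ)),
      Relation.ReflTransGen (Step R) (.sym γ ts) (.sym γ (s.piecewise ts' ts)) := by
    intro s
    induction s using Finset.induction_on with
    | empty => rw [Finset.piecewise_empty]
    | insert i s hi ih =>
      rw [Finset.piecewise_insert]
      exact ih.trans (single _ i _ (by rw [Finset.piecewise_eq_of_notMem _ _ _ hi]; exact h i))
  have := key Finset.univ
  rwa [Finset.piecewise_univ] at this

theorem Term.subst_reflTransGen (hR : SubstStable R) (u : Term S) {σ τ : ℕ → Term S}
    (h : ∀ k, Relation.ReflTransGen (Step R) (σ k) (τ k)) :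
    Relation.ReflTransGen (Step R) (u.subst σ) (u.subst τ) := by
  have lift : ∀ {σ τ : ℕ → Term S}, (∀ k, Relation.ReflTransGen (Step R) (σ k) (τ k)) →
      ∀ k, Relation.ReflTransGen (Step R) (liftSubst σ k) (liftSubst τ k) := by
    intro σ τ h k
    cases k with
    | zero => exact .refl
    | succ k =>
      simp only [liftSubst, Term.rename_eq_subst]
      exact (h k).lift _ fun _ _ h => h.subst hR _
  induction u generalizing σ τ with
  | var k => exact h k
  | lam u ih => exact (ih (lift h)).lift _ fun _ _ h => .lam h
  | pure t ih => exact (ih h).lift _ fun _ _ h => .pure h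
  | app s t ihs iht =>
    exact ((ihs h).lift (fun s => Term.app s _) fun _ _ h => .appL h).trans
      ((iht h).lift _ fun _ _ h => .appR h)
  | sym γ ts ih => exact reflTransGen_sym γ _ _ fun i => ih i h
  | letIn t u iht ihu =>
    exact ((iht h).lift (fun s => Term.letIn s _) fun _ _ h => .letL h).trans
      ((ihu (lift h)).lift _ fun _ _ h => .letR h)

theorem Step.inst_left (hR : SubstStable R) {u u' : Term S} (h : Step R u u') (t : Term S) :
    Step R (u.inst t) (u'.inst t) :=
  h.subst hR _

/-- The variable may occur in `u` any number of times, so one step becomes many, possibly none. -/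
theorem Step.inst_right (hR : SubstStable R) (u : Term S) {t t' : Term S} (h : Step R t t') :
    Relation.ReflTransGen (Step R) (u.inst t) (u.inst t') := by
  refine u.subst_reflTransGen hR fun k => ?_
  cases k with
  | zero => exact .single h
  | succ k => exact .refl

theorem SN.step {s t : Term S} (hs : SN (Step R) s) (h : Step R s t) : SN (Step R) t :=
  hs.inv h

theorem SN.reduces {s t : Term S} (hs : SN (Step R) s)
    (h : Relation.ReflTransGen (Step R) s t) : SN (Step R) t := by
  induction h with
  | refl => exact hs
  | tail _ h ih => exact ih.step h

/-- Strong normalization is reflected by maps that preserve reduction steps. -/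
theorem SN.of_map (f : Term S → Term S) (hf : ∀ s t, Step R s t → Step R (f s) (f t))
    {t : Term S} (h : SN (Step R) (f t)) : SN (Step R) t := by
  have : ∀ x, SN (Step R) x → ∀ t, f t = x → SN (Step R) t := by
    intro x hx
    induction hx with
    | intro x _ ih =>
      rintro t rfl
      exact ⟨_, fun y hy => ih _ (hf _ _ hy) y rfl⟩
  exact this _ h _ rfl

theorem SN.of_inst (hR : SubstStable R) {u t : Term S} (h : SN (Step R) (u.inst t)) :
    SN (Step R) u :=
  h.of_map (fun u => u.inst t) fun _ _ h => h.inst_left hR t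

end Reduction

/-! ### Continuations as stacks of `let` bodies. -/

section Continuations

variable {B : Type u} {S : Signature.{u, v, w} B} {R : Term S → Term S → Prop}

/-- `plug [u₁, …, uₘ] t` is `let ⇐ (… (let ⇐ t in u₁) …) in uₘ`. -/
def plug : List (Term S) → Term S → Term S
  | [], t => t
  | u :: K, t => plug K (.letIn t u)

/-- Reductions of a continuation that are independent of the plugged term. -/
inductive KStep (R : Term S → Term S → Prop) : List (Term S) → List (Term S) → Prop
  | head {u u' : Term S} {K : List (Term S)} (h : Step R u u') : KStep R (u :: K) (u' :: K)
  | tail {u : Term S} {K K' : List (Term S)} (h : KStep R K K') : KStep R (u :: K) (u :: K')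
  | assoc (u₁ u₂ : Term S) (K : List (Term S)) :
      KStep R (u₁ :: u₂ :: K) (.letIn u₁ (u₂.rename (liftRen Nat.succ)) :: K)

/-- Strong normalization of continuations. -/
def KSN (R : Term S → Term S → Prop) (K : List (Term S)) : Prop :=
  Acc (fun K' K => KStep R K K') K

/-- Left-hand sides are headed by effect symbols. -/
def EffHeaded (R : Term S → Term S → Prop) : Prop :=
  ∀ l r, R l r → ∃ e ts, l = .sym (Sum.inl e) ts

theorem Step.plug {t t' : Term S} (h : Step R t t') (K : List (Term S)) :
    Step R (plug K t) (plug K t') := by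
  induction K generalizing t t' with
  | nil => exact h
  | cons u K ih => exact ih (.letL h)

theorem KStep.plug {K K' : List (Term S)} (h : KStep R K K') (t : Term S) :
    Step R (plug K t) (plug K' t) := by
  induction h generalizing t with
  | head h => exact Step.plug (Compat.letR h) _
  | tail _ ih => exact ih _
  | assoc u₁ u₂ K => exact Step.plug (Compat.root (.inr (.letAssoc t u₁ u₂))) _

theorem KStep.length_le {K K' : List (Term S)} (h : KStep R K K') : K'.length ≤ K.length := by
  induction h <;> simp_all

/-- Term and continuation interact only at the innermost `let`. At any outer `let` the bound term is
itself a `let`, so only `letAssoc` can fire there, and that is the step `KStep.assoc` of the stack.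
-/
theorem step_plug_cases (hR : EffHeaded R) {K : List (Term S)} {t x : Term S}
    (h : Step R (plug K t) x) :
    (∃ t', Step R t t' ∧ x = plug K t') ∨ (∃ K', KStep R K K' ∧ x = plug K' t) ∨
      ∃ u K₀ r, K = u :: K₀ ∧ MLRule (.letIn t u) r ∧ x = plug K₀ r := by
  induction K generalizing t x with
  | nil => exact .inl ⟨x, h, rfl⟩
  | cons u K ih =>
    rcases ih h with ⟨t', h', rfl⟩ | ⟨K', h', rfl⟩ | ⟨u₂, K₀, r, rfl, h', rfl⟩
    · cases h' with
      | root h' =>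
        rcases h' with h' | h'
        · obtain ⟨e, ts, he⟩ := hR _ _ h'
          cases he
        · exact .inr (.inr ⟨u, K, _, rfl, h', rfl⟩)
      | letL h' => exact .inl ⟨_, h', rfl⟩
      | letR h' => exact .inr (.inl ⟨_, .head h', rfl⟩)
    · exact .inr (.inl ⟨_, .tail h', rfl⟩)
    · cases h' with
      | letAssoc => exact .inr (.inl ⟨_, .assoc _ _ _, rfl⟩)

theorem SN.ksn {K : List (Term S)} {t : Term S} (h : SN (Step R) (plug K t)) : KSN R K := by
  have : ∀ x, SN (Step R) x → ∀ K, plug K t = x → KSN R K := by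
    intro x hx
    induction hx with
    | intro x _ ih =>
      rintro K rfl
      exact ⟨_, fun K' h => ih _ (h.plug t) K' rfl⟩
  exact this _ h _ rfl

theorem KSN.of_cons {u : Term S} {K : List (Term S)} (h : KSN R (u :: K)) : KSN R K := by
  have : ∀ L, KSN R L → ∀ K, L = u :: K → KSN R K := by
    intro L hL
    induction hL with
    | intro L _ ih =>
      rintro K rfl
      exact ⟨_, fun K' h => ih _ (.tail h) K' rfl⟩
  exact this _ h _ rfl

theorem SN.pure {t : Term S} (hR : EffHeaded R) (h : SN (Step R) t) : SN (Step R) (.pure t) := by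
  induction h with
  | intro t _ ih =>
    refine ⟨_, fun x hx => ?_⟩
    cases hx with
    | root h =>
      rcases h with h | h
      · obtain ⟨e, ts, he⟩ := hR _ _ h
        cases he
      · cases h
    | pure h => exact ih _ h

/-- Terms that create no redex when they are applied or bound. -/
inductive Neutral : Term S → Prop
  | var (k : ℕ) : Neutral (.var k)
  | app (s t : Term S) : Neutral (.app s t)
  | fn (f : S.fns.Fn) (ts : Fin (S.fns.arity f) → Term S) : Neutral (.sym (Sum.inr f) ts)

/-- A neutral term cannot interact with the innermost `let`, so every step happens in `t` or in `K`,
and induction on `K` suffices. -/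
theorem Neutral.sn_plug (hR : EffHeaded R) {t : Term S} (ht : Neutral t) {K : List (Term S)}
    (hK : KSN R K) (h : ∀ t', Step R t t' → SN (Step R) (AlgEff.plug K t')) :
    SN (Step R) (AlgEff.plug K t) := by
  induction hK with
  | intro K _ ih =>
    refine ⟨_, fun x hx => ?_⟩
    rcases step_plug_cases hR hx with ⟨t', h', rfl⟩ | ⟨K', h', rfl⟩ | ⟨u, K₀, r, rfl, h', rfl⟩
    · exact h _ h'
    · exact ih _ h' fun t' ht' => (h t' ht').step (h'.plug _)
    · cases ht <;> cases h'

/-- `let x ⇐ pure v in u` under a continuation terminates if `u{v/x}` does. -/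
theorem SN.plug_letBeta (hR : EffHeaded R) (hS : SubstStable R) {v : Term S}
    (hv : SN (Step R) v) (u : Term S) (K : List (Term S)) (h : SN (Step R) (plug K (u.inst v))) :
    SN (Step R) (plug (u :: K) (.pure v)) := by
  induction hv generalizing u K with
  | intro v _ ihv =>
  -- The measure is `v`, then `p = plug K (u.inst v)`, then the length of `K`. The outer induction
  -- on `v` is needed because a step of `v` leaves `p` fixed when the variable does not occur in
  -- `u`.
  have main : ∀ p, SN (Step R) p → ∀ n K u, K.length ≤ n → plug K (u.inst v) = p →
      SN (Step R) (plug (u :: K) (.pure v)) := by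
    intro p hp
    induction hp with
    | intro p hp ihp =>
    intro n
    induction n using Nat.strong_induction_on with
    | h n ihn =>
    rintro K u hn rfl
    refine ⟨_, fun x hx => ?_⟩
    rcases step_plug_cases hR hx with ⟨t', h', rfl⟩ | ⟨K', h', rfl⟩ | ⟨u, K₀, r, hK, h', rfl⟩
    · cases h' with
      | root h =>
        rcases h with h | h
        · obtain ⟨e, ts, he⟩ := hR _ _ h
          cases he
        · cases h
      | pure h' =>
        exact ihv _ h' _ _ (SN.reduces ⟨_, hp⟩
          ((Step.inst_right hS u h').lift (plug K) fun _ _ h => h.plug K))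
    · cases h' with
      | head h' => exact ihp _ ((h'.inst_left hS v).plug K) _ K _ le_rfl rfl
      | tail h' => exact ihp _ (h'.plug _) _ _ _ le_rfl rfl
      | assoc _ u₂ K₀ =>
        -- Merging two stack entries by associativity does not change the instantiated term `p`;
        -- only the stack gets shorter.
        refine ihn K₀.length hn K₀ _ le_rfl ?_
        simp only [Term.inst, Term.subst, Term.rename_liftRen_succ_subst_instVar]
        rfl
    · cases hK
      cases h' with
      | letBeta => exact ⟨_, hp⟩
  exact main _ h _ K u le_rfl rfl

end Continuations

/-! ### Lexicographic descent of tuples. -/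

section Lexicographic

/-- Lexicographic descent between tuples with accessible entries. -/
def LexDescent {α : Type*} (r : α → α → Prop) {n : ℕ} (b a : Fin n → α) : Prop :=
  (∃ k, (∀ j < k, b j = a j) ∧ r (b k) (a k)) ∧ ∀ j, Acc r (b j)

theorem acc_lexDescent {α : Type*} {r : α → α → Prop} {n : ℕ} (a : Fin n → α)
    (h : ∀ j, Acc r (a j)) : Acc (LexDescent r) a := by
  -- Although `r` need not be well-founded, its restriction to accessible elements is, which makes
  -- the lexicographic product on `Fin n` available.
  have wf : WellFounded fun x y : {x // Acc r x} => r x.1 y.1 :=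
    ⟨fun x => by
      obtain ⟨x, hx⟩ := x
      induction hx with
      | intro x hx ih => exact ⟨_, fun y hy => ih y.1 hy⟩⟩
  have lex := Pi.Lex.wellFounded (ι := Fin n) (· < ·) (fun _ => wf)
  have : ∀ f : Fin n → {x // Acc r x}, Acc (LexDescent r) fun j => (f j).1 := by
    intro f
    induction f using lex.induction with
    | h f ih =>
      refine ⟨_, fun b hb => ?_⟩
      obtain ⟨⟨k, heq, hk⟩, hb⟩ := hb
      exact ih (fun j => ⟨b j, hb j⟩) ⟨k, fun j hj => Subtype.ext (heq j hj), hk⟩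
  exact this fun j => ⟨a j, h j⟩

theorem lexDescent_update {α : Type*} {r : α → α → Prop} {n : ℕ} {a : Fin n → α}
    (h : ∀ j, Acc r (a j)) {i : Fin n} {x : α} (hx : r x (a i)) :
    LexDescent r (Function.update a i x) a := by
  refine ⟨⟨i, fun j hj => Function.update_of_ne hj.ne _ _, by rwa [Function.update_self]⟩,
    fun j => ?_⟩
  rcases eq_or_ne j i with rfl | hj
  · rw [Function.update_self]
    exact (h j).inv hx
  · rw [Function.update_of_ne hj]
    exact h j

end Lexicographic

/-! ### Termination of effect terms under a continuation. -/

section Effects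

variable {B : Type u} {S : Signature.{u, v, w} B} {R : Term S → Term S → Prop}

/-- `ArgOf t s`: the term `t` is an argument of the effect term `s`. -/
inductive ArgOf : Term S → Term S → Prop
  | mk (e : S.Eff) (ts : Fin (S.effArity e) → Term S) (i : Fin (S.effArity e)) :
      ArgOf (ts i) (.sym (Sum.inl e) ts)

/-- Descent by reduction steps and by passing to arguments of effects. -/
def Descent (R : Term S → Term S → Prop) : Term S → Term S → Prop :=
  Relation.TransGen fun t s => Step R s t ∨ ArgOf t s

theorem ArgOf.step {s t t' : Term S} (h : ArgOf t s) (ht : Step R t t') :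
    ∃ s', Step R s s' ∧ ArgOf t' s' := by
  obtain ⟨e, ts, i⟩ := h
  refine ⟨_, Compat.sym (Sum.inl e) ts i ht, ?_⟩
  have := ArgOf.mk e (Function.update ts i t') i
  rwa [Function.update_self] at this

theorem ArgOf.reflTransGen_step {s t t' : Term S} (h : Relation.ReflTransGen ArgOf t s)
    (ht : Step R t t') : ∃ s', Step R s s' ∧ Relation.ReflTransGen ArgOf t' s' := by
  induction h with
  | refl => exact ⟨t', ht, .refl⟩
  | tail _ h ih =>
    obtain ⟨s₁, h₁, h₁'⟩ := ih
    obtain ⟨s₂, h₂, h₂'⟩ := h.step h₁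
    exact ⟨s₂, h₂, h₁'.tail h₂'⟩

/-- Passing to an argument can be postponed: a step in a nested effect argument of `t` is also a
step of `t`. So the induction is on termination of `t` first and on the structure of the nested
argument second. -/
theorem SN.acc_descent {t : Term S} (h : SN (Step R) t) : Acc (Descent R) t := by
  refine Acc.transGen ?_
  have : ∀ s, Relation.ReflTransGen ArgOf s t →
      Acc (fun t s => Step R s t ∨ ArgOf t s) s := by
    induction h with
    | intro t _ ih =>
      intro s
      induction s with
      | sym γ ts ihs =>
        refine fun hs => ⟨_, fun x hx => ?_⟩
        rcases hx with hx | hx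
        · obtain ⟨t', ht', hx'⟩ := ArgOf.reflTransGen_step hs hx
          exact ih t' ht' _ hx'
        · cases hx with
          | mk e ts i => exact ihs i (.head (.mk e ts i) hs)
      | _ =>
        refine fun hs => ⟨_, fun x hx => ?_⟩
        rcases hx with hx | hx
        · obtain ⟨t', ht', hx'⟩ := ArgOf.reflTransGen_step hs hx
          exact ih t' ht' _ hx'
        · cases hx
  exact this t .refl

theorem SN.of_descent {s t : Term S} (hs : SN (Step R) s) (h : Descent R t s) :
    SN (Step R) t := by
  have hacc := hs.acc_descent.inv h
  clear h hs
  induction hacc with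
  | intro t _ ih => exact ⟨_, fun y hy => ih y (.single (.inl hy))⟩

theorem Step.descent {s t : Term S} (h : Step R s t) : Descent R t s :=
  .single (.inl h)

/-- The rule `effAssoc` moves the effect outwards through all of `K`; afterwards `plug K t` is one
of its arguments. -/
theorem ArgOf.descent_plug {s t : Term S} (h : ArgOf t s) (K : List (Term S)) :
    Descent R (plug K t) (plug K s) := by
  induction K generalizing s t with
  | nil => exact .single (.inr h)
  | cons u K ih =>
    obtain ⟨e, ts, i⟩ := h
    refine (ih (ArgOf.mk e (fun i => .letIn (ts i) u) i)).trans (Step.descent ?_)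
    exact Step.plug (Compat.root (.inr (.effAssoc e ts u))) K

/-- The part of the recursive path ordering below `e(ts)` that compares effect terms only and
where the deciding argument is replaced by one of its own arguments. -/
inductive Below (gt : S.Eff → S.Eff → Prop) (e : S.Eff) (ts : Fin (S.effArity e) → Term S) :
    Term S → Prop
  | arg (i : Fin (S.effArity e)) : Below gt e ts (ts i)
  | sub {s t : Term S} (hs : Below gt e ts s) (h : ArgOf t s) : Below gt e ts t
  | prec (e' : S.Eff) (ss : Fin (S.effArity e') → Term S) (hgt : gt e e')
      (h : ∀ j, Below gt e ts (ss j)) : Below gt e ts (.sym (Sum.inl e') ss)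
  | lex (ss : Fin (S.effArity e) → Term S) (k : Fin (S.effArity e)) (heq : ∀ j < k, ss j = ts j)
      (hk : ArgOf (ss k) (ts k)) (h : ∀ j, Below gt e ts (ss j)) :
      Below gt e ts (.sym (Sum.inl e) ss)

/-- Rewrite rules between effect terms that decrease along `Below`. -/
structure EffectRules (gt : S.Eff → S.Eff → Prop) (R : Term S → Term S → Prop) : Prop where
  wf : WellFounded fun a b => gt b a
  headed : EffHeaded R
  stable : SubstStable R
  below : ∀ e ts r, R (.sym (Sum.inl e) ts) r → Below gt e ts r

variable {gt : S.Eff → S.Eff → Prop}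

theorem EffectRules.sn_plug_eff (hR : EffectRules gt R) (e : S.Eff)
    (ts : Fin (S.effArity e) → Term S) {K : List (Term S)} (hK : KSN R K)
    (h : ∀ i, SN (Step R) (plug K (ts i))) : SN (Step R) (plug K (.sym (Sum.inl e) ts)) := by
  induction e using hR.wf.induction generalizing K with
  | h e ihe =>
  -- The tuple `X` of plugged arguments and the bound `n` on the length of `K` are separate
  -- parameters, so that `K` may change freely as long as `X` descends.
  have main : ∀ X : Fin (S.effArity e) → Term S, Acc (LexDescent (Descent R)) X →
      ∀ (n : ℕ) (K : List (Term S)), KSN R K → K.length ≤ n →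
        ∀ ts : Fin (S.effArity e) → Term S, (fun i => plug K (ts i)) = X →
          (∀ i, SN (Step R) (plug K (ts i))) → SN (Step R) (plug K (.sym (Sum.inl e) ts)) := by
    intro X hX
    induction hX with
    | intro X _ ihX =>
    intro n
    induction n using Nat.strong_induction_on with
    | h n ihn =>
    intro K hK
    induction hK with
    | intro K hK ihK =>
    rintro hn ts rfl h
    have hKSN : KSN R K := ⟨_, hK⟩
    have hacc := fun i => (h i).acc_descent
    -- Right-hand sides terminate under the same `K`, by induction on `Below`: a smaller symbol uses
    -- the induction on `e`, the same symbol uses the descent of `X`.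
    have below : ∀ r, Below gt e ts r → SN (Step R) (plug K r) := by
      intro r hr
      induction hr with
      | arg i => exact h i
      | sub _ ha ih => exact ih.of_descent (ha.descent_plug K)
      | prec e' ss hgt _ ih => exact ihe e' hgt ss hKSN ih
      | lex ss k heq hk _ ih =>
        refine ihX (fun i => plug K (ss i)) ?_ n K hKSN hn ss rfl ih
        exact ⟨⟨k, fun j hj => congrArg (plug K) (heq j hj), hk.descent_plug K⟩,
          fun j => (ih j).acc_descent⟩
    refine ⟨_, fun x hx => ?_⟩
    rcases step_plug_cases hR.headed hx with
      ⟨t', h', rfl⟩ | ⟨K', h', rfl⟩ | ⟨u, K₀, r, rfl, h', rfl⟩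
    · cases h' with
      | root h' =>
        rcases h' with h' | h'
        · exact below _ (hR.below _ _ _ h')
        · cases h'
      | @sym _ _ i t' h' =>
        have hupd : (fun j => plug K (Function.update ts i t' j)) =
            Function.update (fun j => plug K (ts j)) i (plug K t') :=
          funext fun j => Function.apply_update (fun _ => plug K) ts i t' j
        have hlex := lexDescent_update hacc (Step.plug h' K).descent
        refine ihX _ hlex n K hKSN hn _ hupd fun j => ?_
        rcases eq_or_ne j i with rfl | hj
        · rw [Function.update_self]
          exact (h j).step (Step.plug h' K)
        · rw [Function.update_of_ne hj]
          exact h j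
    · have hSN : ∀ j, SN (Step R) (plug K' (ts j)) := fun j => (h j).step (h'.plug _)
      -- A step of `K` lowers every entry of `X`, hence the first one. For a nullary effect `X` has
      -- no entries, and termination of `K` itself is used instead.
      rcases isEmpty_or_nonempty (Fin (S.effArity e)) with hempty | ⟨⟨i⟩⟩
      · exact ihK K' h' (h'.length_le.trans hn) ts (funext fun j => hempty.elim j) hSN
      · refine ihX (fun j => plug K' (ts j)) ?_ K'.length K' (hKSN.inv h') le_rfl ts rfl hSN
        have : NeZero (S.effArity e) := ⟨by have := i.2; omega⟩
        exact ⟨⟨0, fun j hj => absurd hj (Fin.not_lt_zero j), (h'.plug _).descent⟩,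
          fun j => (hSN j).acc_descent⟩
    · cases h' with
      | effAssoc =>
        -- Here `X` is literally unchanged, since `plug (u :: K₀) (ts i)` unfolds to `plug K₀ (let
        -- ts i in u)`; the stack is shorter.
        exact ihn K₀.length hn K₀ hKSN.of_cons le_rfl (fun i => .letIn (ts i) u) rfl h
  exact main _ (acc_lexDescent _ fun i => (h i).acc_descent) _ K hK le_rfl ts rfl h

end Effects

/-! ### Reducibility and its fundamental lemma. -/

section Reducibility

variable {B : Type u} {S : Signature.{u, v, w} B} {R : Term S → Term S → Prop}
  {gt : S.Eff → S.Eff → Prop}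

/-- Reducible terms; at computation types by biorthogonality with respect to the reducible
continuations. -/
def Red (R : Term S → Term S → Prop) : Ty B → Term S → Prop
  | .base _, t => SN (Step R) t
  | .comp T, t =>
      ∀ K, (∀ v, Red R T v → SN (Step R) (plug K (.pure v))) → SN (Step R) (plug K t)
  | .arrow A T, t => ∀ s, Red R A s → Red R T (.app t s)

theorem EffHeaded.neutral (hR : EffHeaded R) {t r : Term S} (ht : Neutral t) : ¬ R t r := by
  intro h
  obtain ⟨e, ts, rfl⟩ := hR _ _ h
  cases ht

/-- These are Girard's three conditions, proved together: termination at an arrow type needs a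
reducible variable, which the third condition supplies. -/
theorem EffHeaded.red (hR : EffHeaded R) (T : Ty B) :
    (∀ t, Red R T t → SN (Step R) t) ∧
      (∀ t t', Red R T t → Step R t t' → Red R T t') ∧
      (∀ t, Neutral t → (∀ t', Step R t t' → Red R T t') → Red R T t) := by
  induction T with
  | base b =>
    exact ⟨fun _ h => h, fun _ _ h h' => h.step h', fun t _ h => ⟨_, h⟩⟩
  | comp T ih =>
    refine ⟨fun t ht => ht [] fun v hv => SN.pure hR (ih.1 v hv),
      fun t t' ht h K hK => (ht K hK).step (h.plug K), fun t hn ht K hK => ?_⟩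
    -- Testing `K` on one reducible value shows that `K` terminates.
    have hv : Red R T (.var 0) := ih.2.2 _ (.var 0) fun t' h => by
      cases h with
      | root h => exact h.elim (fun h => absurd h (hR.neutral (.var 0))) nofun
    exact hn.sn_plug hR (hK _ hv).ksn fun t' h => ht t' h K hK
  | arrow A T ihA ihT =>
    refine ⟨fun t ht => ?_, fun t t' ht h s hs => ihT.2.1 _ _ (ht s hs) (.appL h),
      fun t hn ht s hs => ?_⟩
    · have hv : Red R A (.var 0) := ihA.2.2 _ (.var 0) fun t' h => by
        cases h with
        | root h => exact h.elim (fun h => absurd h (hR.neutral (.var 0))) nofun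
      exact (ihT.1 _ (ht _ hv)).of_map (fun t => .app t (.var 0)) fun _ _ h => .appL h
    · have hsn := ihA.1 s hs
      induction hsn with
      | intro s _ ih =>
        refine ihT.2.2 _ (.app t s) fun x hx => ?_
        cases hx with
        | root h =>
          rcases h with h | h
          · exact absurd h (hR.neutral (.app t s))
          · cases h
            cases hn
        | appL h => exact ht _ h s hs
        | appR h => exact ih _ h (ihA.2.1 _ _ hs h)

theorem EffHeaded.red_var (hR : EffHeaded R) (T : Ty B) (k : ℕ) : Red R T (.var k) :=
  (hR.red T).2.2 _ (.var k) fun t' h => by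
    cases h with
    | root h => exact h.elim (fun h => absurd h (hR.neutral (.var k))) nofun

theorem EffHeaded.red_reduces (hR : EffHeaded R) {T : Ty B} {s t : Term S} (hs : Red R T s)
    (h : Relation.ReflTransGen (Step R) s t) : Red R T t := by
  induction h with
  | refl => exact hs
  | tail _ h ih => exact (hR.red T).2.1 _ _ ih h

/-- The redex is neutral, so it suffices that all its reducts are reducible. Termination of `s` is
assumed separately because `u.inst s` may have lost `s`. -/
theorem EffHeaded.red_beta (hR : EffHeaded R) (hS : SubstStable R) {T : Ty B} {u s : Term S}
    (hs : SN (Step R) s) (h : Red R T (u.inst s)) : Red R T (.app (.lam u) s) := by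
  have hu : SN (Step R) u := SN.of_inst hS ((hR.red T).1 _ h)
  induction hu generalizing s with
  | intro u _ ihu =>
    induction hs with
    | intro s hs ihs =>
      refine (hR.red T).2.2 _ (.app _ _) fun x hx => ?_
      cases hx with
      | root hx =>
        rcases hx with hx | hx
        · exact absurd hx (hR.neutral (.app _ _))
        · cases hx
          exact h
      | appL hx =>
        cases hx with
        | root hx =>
          rcases hx with hx | hx
          · obtain ⟨e, ts, he⟩ := hR _ _ hx
            cases he
          · cases hx
        | lam hx => exact ihu _ hx ⟨_, hs⟩ ((hR.red T).2.1 _ _ h (Step.inst_left hS hx s))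
      | appR hx =>
        refine ihs _ hx ?_
        exact hR.red_reduces h (Step.inst_right hS u hx)

/-- If `K` is an admissible test for `E(T)`, then `u :: K` is one for `E(A)`. -/
theorem EffHeaded.red_letIn (hR : EffHeaded R) (hS : SubstStable R) {A T : Ty B} {t u : Term S}
    (ht : Red R (.comp A) t) (hu : ∀ v, Red R A v → Red R (.comp T) (u.inst v)) :
    Red R (.comp T) (.letIn t u) :=
  fun K hK => ht (u :: K) fun v hv =>
    SN.plug_letBeta hR hS ((hR.red A).1 v hv) u K (hu v hv K hK)

/-- Function symbols have no rules, so such a term is neutral and only its arguments reduce. -/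
theorem EffHeaded.red_fn (hR : EffHeaded R) (T : Ty B) (f : S.fns.Fn)
    (ts : Fin (S.fns.arity f) → Term S) (h : ∀ i, SN (Step R) (ts i)) :
    Red R T (.sym (Sum.inr f) ts) := by
  have hacc := acc_lexDescent ts h
  induction hacc with
  | intro ts _ ih =>
    refine (hR.red T).2.2 _ (.fn f ts) fun x hx => ?_
    cases hx with
    | root hx =>
      rcases hx with hx | hx
      · exact absurd hx (hR.neutral (.fn f ts))
      · cases hx
    | @sym _ _ i t' hx =>
      have hlex := lexDescent_update h (r := fun b a => Step R a b) hx
      exact ih _ hlex hlex.2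

theorem EffectRules.red_eff (hR : EffectRules gt R) {T : Ty B} (e : S.Eff)
    (ts : Fin (S.effArity e) → Term S) (h : ∀ i, Red R (.comp T) (ts i)) :
    Red R (.comp T) (.sym (Sum.inl e) ts) :=
  fun K hK => hR.sn_plug_eff e ts (hK _ (hR.headed.red_var T 0)).ksn fun i => h i K hK

/-- The fundamental lemma; the substitution is needed to pass under binders, and the identity
substitution later gives the result for `t`. -/
theorem EffectRules.red_subst (hR : EffectRules gt R) {Γ : List (Ty B)} {t : Term S} {T : Ty B}
    (h : HasType Γ t T) (σ : ℕ → Term S) (hσ : ∀ k A, Γ[k]? = some A → Red R A (σ k)) :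
    Red R T (t.subst σ) := by
  have extend : ∀ {Γ : List (Ty B)} {A : Ty B} {σ : ℕ → Term S} {s : Term S},
      (∀ k A, Γ[k]? = some A → Red R A (σ k)) → Red R A s →
        ∀ k A', (A :: Γ)[k]? = some A' →
          Red R A' ((fun | 0 => s | k + 1 => σ k : ℕ → Term S) k) := by
    intro Γ A σ s hσ hs k A' hk
    cases k with
    | zero =>
      obtain rfl : A = A' := by simpa using hk
      exact hs
    | succ k => exact hσ k A' (by simpa using hk)
  induction h generalizing σ with
  | var h => exact hσ _ _ h
  | @lam Γ u A T _ ih =>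
    intro s hs
    refine hR.headed.red_beta hR.stable ((hR.headed.red A).1 s hs) ?_
    rw [Term.inst_of_subst_liftSubst]
    exact ih _ (extend hσ hs)
  | app _ _ ihs iht => exact ihs σ hσ _ (iht σ hσ)
  | letIn _ _ iht ihu =>
    refine hR.headed.red_letIn hR.stable (iht σ hσ) fun v hv => ?_
    rw [Term.inst_of_subst_liftSubst]
    exact ihu _ (extend hσ hv)
  | pure _ ih => exact fun K hK => hK _ (ih σ hσ)
  | eff e ts _ ih => exact hR.red_eff e _ fun i => ih i σ hσ
  | fn f ts _ ih => exact hR.headed.red_fn _ f _ fun i => (hR.headed.red _).1 _ (ih i σ hσ)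

/-- Well-typed terms are strongly normalizing under effect rules and the metalanguage rules. -/
theorem EffectRules.typedSN (hR : EffectRules gt R) : TypedSN R := by
  intro Γ t T h
  have := hR.red_subst h Term.var fun k A _ => hR.headed.red_var A k
  rw [Term.subst_var] at this
  exact (hR.headed.red T).1 _ this

end Reducibility

/-! ### Orders with two levels. -/

section TwoLevel

variable {α : Type*} {P Q : α → Prop}

/-- The levels are disjoint, so no two descents can be composed. -/
theorem wellFounded_twoLevel (h : ∀ a, P a → ¬ Q a) : WellFounded fun b a => P a ∧ Q b :=
  ⟨fun _ => ⟨_, fun _ hb => ⟨_, fun _ hc => absurd hb.2 (h _ hc.1)⟩⟩⟩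

theorem isStrictOrder_twoLevel (h : ∀ a, P a → ¬ Q a) :
    IsStrictOrder α fun a b => P a ∧ Q b where
  irrefl a ha := h a ha.1 ha.2
  trans _ _ _ hab hbc := ⟨hab.1, hbc.2⟩

theorem isPrecedence_twoLevel {B : Type u} {S : Signature.{u, v, w} B} {P Q : S.Symbol → Prop}
    (h : ∀ a, P a → ¬ Q a) : IsPrecedence fun a b => P a ∧ Q b :=
  ⟨isStrictOrder_twoLevel h, wellFounded_twoLevel h⟩

end TwoLevel

/-! ### Global state. -/

namespace GlobalState

variable {B : Type u} {F : FunctionSymbols.{u, w} B} {n : ℕ}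

theorem containedInRPO (gt : (sig F n).Symbol → (sig F n).Symbol → Prop) :
    ContainedInRPO gt (Rule (F := F) (n := n)) := by
  intro l r h
  cases h with
  | assignGet i ts =>
    exact RPO.lex (S := sig F n) (Sum.inl (Eff.assign i)) (fun _ => get ts) (fun _ => ts i)
      (0 : Fin 1)
      (fun j hj => absurd hj (Fin.not_lt_zero j)) (RPO.argEq (S := sig F n) (Sum.inl Eff.get) ts i)
      fun _ => RPO.argGt (S := sig F n) (Sum.inl (Eff.assign i)) _ (0 : Fin 1)
        (RPO.argEq (S := sig F n) (Sum.inl Eff.get) ts i)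
  | assignAssign i j s =>
    exact RPO.argEq (S := sig F n) (Sum.inl (Eff.assign i)) (fun _ => assign j s) (0 : Fin 1)
  | getGet ts i ss h =>
    have hi : RPO gt (ts i) (ss i) := h ▸ RPO.argEq (S := sig F n) (Sum.inl Eff.get) ss i
    refine RPO.lex (S := sig F n) (Sum.inl Eff.get) ts (Function.update ts i (ss i)) i
      (fun j hj => (Function.update_of_ne hj.ne _ _).symm) ?_ fun j => ?_
    · rwa [Function.update_self]
    · rcases eq_or_ne j i with rfl | hj
      · rw [Function.update_self]
        exact RPO.argGt (S := sig F n) (Sum.inl Eff.get) ts j hi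
      · rw [Function.update_of_ne hj]
        exact RPO.argEq (S := sig F n) (Sum.inl Eff.get) ts j

theorem rule_headed : EffHeaded (Rule (F := F) (n := n)) := by
  intro l r h
  cases h <;> exact ⟨_, _, rfl⟩

theorem rule_stable : SubstStable (Rule (F := F) (n := n)) := by
  intro l r σ h
  cases h with
  | assignGet i ts => exact .assignGet i fun j => (ts j).subst σ
  | assignAssign i j s => exact .assignAssign i j (s.subst σ)
  | getGet ts i ss h =>
    simp only [get, Term.subst]
    rw [subst_update]
    exact .getGet _ i (fun j => (ss j).subst σ) (by rw [h]; rfl)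

theorem rule_below {l r : Term (sig F n)} (h : Rule l r) (e : (sig F n).Eff)
    (ts : Fin ((sig F n).effArity e) → Term (sig F n)) (hl : l = .sym (Sum.inl e) ts) :
    Below (fun _ _ => False) e ts r := by
  cases h with
  | assignGet i ts =>
    cases hl
    have ha : ArgOf (ts i) (get ts) := ArgOf.mk (S := sig F n) Eff.get ts i
    exact .lex (fun _ => ts i) (0 : Fin 1) (fun j hj => absurd hj (Fin.not_lt_zero j)) ha
      fun _ => .sub (.arg (0 : Fin 1)) ha
  | assignAssign i j s =>
    cases hl
    exact .arg (0 : Fin 1)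
  | getGet ts i ss h =>
    cases hl
    -- The `i`-th argument decides the comparison: it is replaced by its own `i`-th argument, the
    -- others stay.
    have ha : ArgOf (ss i) (ts i) := h ▸ ArgOf.mk (S := sig F n) Eff.get ss i
    refine Below.lex (S := sig F n) (e := Eff.get) (Function.update ts i (ss i)) i
      (fun j hj => Function.update_of_ne hj.ne _ _) ?_ fun j => ?_
    · rwa [Function.update_self]
    · rcases eq_or_ne j i with rfl | hj
      · rw [Function.update_self]
        exact .sub (.arg j) ha
      · rw [Function.update_of_ne hj]
        exact .arg j

theorem effectRules : EffectRules (fun _ _ => False) (Rule (F := F) (n := n)) where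
  wf := ⟨fun _ => ⟨_, fun _ h => h.elim⟩⟩
  headed := rule_headed
  stable := rule_stable
  below e ts _ h := rule_below h e ts rfl

theorem assign_injective {i j : Fin n} {s t : Term (sig F n)} (h : assign i s = assign j t) :
    i = j ∧ s = t := by
  simp only [assign, Term.sym.injEq, Sum.inl.injEq, Eff.assign.injEq] at h
  obtain ⟨rfl, h⟩ := h
  exact ⟨rfl, congrFun (eq_of_heq h) (0 : Fin 1)⟩

theorem get_injective {ss ts : Fin n → Term (sig F n)} (h : get ss = get ts) : ss = ts := by
  simp only [get, Term.sym.injEq] at h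
  exact eq_of_heq h.2

theorem assign_ne_get (i : Fin n) (t : Term (sig F n)) (ts : Fin n → Term (sig F n)) :
    assign i t ≠ get ts := by
  simp [assign, get]

theorem IsTrace.of_assign {i : Fin n} {t : Term (sig F n)} (h : IsTrace (GlobalState.assign i t)) :
    IsTrace t := by
  generalize hx : GlobalState.assign i t = x at h
  cases h with
  | pure v => cases hx
  | assign j s hs => exact (assign_injective hx).2 ▸ hs
  | get ts _ => exact absurd hx (assign_ne_get i t ts)

theorem IsTrace.of_get {ts : Fin n → Term (sig F n)}
    (h : IsTrace (GlobalState.get ts)) (j : Fin n) :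
    IsTrace (ts j) := by
  generalize hx : GlobalState.get ts = x at h
  cases h with
  | pure v => cases hx
  | assign i s hs => exact absurd hx.symm (assign_ne_get i s ts)
  | get ss hs => exact get_injective hx ▸ hs j

theorem IsTrace.rule {l r : Term (sig F n)} (hl : IsTrace l) (h : Rule l r) : IsTrace r := by
  cases h with
  | assignGet i ts => exact .assign i _ (hl.of_assign.of_get i)
  | assignAssign i j s => exact hl.of_assign
  | getGet ts i ss h =>
    refine .get _ fun j => ?_
    rcases eq_or_ne j i with rfl | hj
    · rw [Function.update_self]
      exact (h ▸ hl.of_get j : IsTrace (GlobalState.get ss)).of_get j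
    · rw [Function.update_of_ne hj]
      exact hl.of_get j

theorem step_assign {i : Fin n} {t t' : Term (sig F n)} (h : Step Rule t t') :
    Step Rule (assign i t) (assign i t') := by
  have := Compat.sym (R := fun s t => Rule (F := F) (n := n) s t ∨ MLRule s t)
    (Sum.inl (Eff.assign i)) (fun _ => t) (0 : Fin 1) h
  rwa [show Function.update (fun _ => t) (0 : Fin 1) t' = fun _ => t' from
    funext fun j => by rw [Subsingleton.elim j 0, Function.update_self]] at this

theorem step_get {ts : Fin n → Term (sig F n)} {i : Fin n} {t' : Term (sig F n)}
    (h : Step Rule (ts i) t') : Step Rule (get ts) (get (Function.update ts i t')) :=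
  Compat.sym (S := sig F n) (Sum.inl Eff.get) ts i h

theorem IsTrace.step {t t' : Term (sig F n)} (ht : IsTrace t) (h : Step Rule t t') :
    IsTrace t' := by
  induction ht generalizing t' with
  | pure v =>
    cases h with
    | root h =>
      rcases h with h | h
      · exact (IsTrace.pure v).rule h
      · cases h
    | pure h => exact .pure _
  | assign i t ht ih =>
    cases h with
    | root h =>
      rcases h with h | h
      · exact (IsTrace.assign i t ht).rule h
      · cases h
    | @sym _ _ j s h =>
      rw [show Function.update (fun _ => t) j s = fun _ => s from
        funext fun k => by rw [Subsingleton.elim (α := Fin 1) k j, Function.update_self]]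
      exact .assign i s (ih h)
  | get ts hts ih =>
    cases h with
    | root h =>
      rcases h with h | h
      · exact (IsTrace.get ts hts).rule h
      · cases h
    | @sym _ _ j s h =>
      refine .get (Function.update ts j s) fun k => ?_
      rcases eq_or_ne k j with rfl | hk
      · rw [Function.update_self]
        exact ih k h
      · rw [Function.update_of_ne hk]
        exact hts k

theorem IsTrace.reduces {t t' : Term (sig F n)} (ht : IsTrace t)
    (h : Relation.ReflTransGen (Step Rule) t t') : IsTrace t' := by
  induction h with
  | refl => exact ht
  | tail _ h ih => exact ih.step h

/-- Subtraces of a normal trace are normal, hence states by induction; every way of putting one more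
effect on top that leaves the shape of a state creates a redex. -/
theorem IsTrace.isState {t : Term (sig F n)} (ht : IsTrace t) (h : IsNormal (Step Rule) t) :
    IsState t := by
  induction ht with
  | pure v => exact .outcome _ (.pure v)
  | assign i t _ ih =>
    have hs := ih fun t' h' => h _ (step_assign h')
    cases hs with
    | outcome _ ho =>
      cases ho with
      | pure v => exact .outcome _ (.assign i v)
      | assign j v => exact absurd (Compat.root (.inl (.assignAssign i j _))) (h _)
    | get ts _ => exact absurd (Compat.root (.inl (.assignGet i ts))) (h _)
  | get ts _ ih =>
    refine .get ts fun j => ?_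
    have hs := ih j fun t' h' => h _ (step_get h')
    generalize hx : ts j = x at hs
    cases hs with
    | outcome _ ho => exact ho
    | get ss _ => exact absurd (Compat.root (.inl (.getGet ts j ss hx))) (h _)

end GlobalState

theorem SN.exists_normal {B : Type u} {S : Signature.{u, v, w} B}
    {step : Term S → Term S → Prop} {t : Term S} (h : SN step t) :
    ∃ t', Relation.ReflTransGen step t t' ∧ IsNormal step t' := by
  induction h with
  | intro t _ ih =>
    by_cases hn : IsNormal step t
    · exact ⟨t, .refl, hn⟩
    · obtain ⟨s, hs⟩ := not_forall_not.mp hn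
      obtain ⟨t', h, h'⟩ := ih s hs
      exact ⟨t', .head hs h, h'⟩

theorem subst_pair {B : Type u} {S : Signature.{u, v, w} B} (s t : Term S) (σ : ℕ → Term S) :
    (fun i => (![s, t] i).subst σ) = ![s.subst σ, t.subst σ] := by
  funext i
  fin_cases i <;> rfl

/-! ### Nondeterminism. -/

namespace Nondet

variable {B : Type u} {F : FunctionSymbols.{u, w} B}

theorem containedInRPO (gt : (sig F).Symbol → (sig F).Symbol → Prop) :
    ContainedInRPO gt (Rule (F := F)) := by
  intro l r h
  obtain ⟨s₁, s₂, s₃⟩ := h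
  have arg : ∀ (s t : Term (sig F)) (i : Fin 2), RPO gt (or s t) (![s, t] i) :=
    fun s t i => RPO.argEq (S := sig F) (Sum.inl Eff.or) ![s, t] i
  have inner : ∀ i : Fin 2, RPO gt (or (or s₁ s₂) s₃) (![s₁, s₂] i) :=
    fun i => RPO.argGt (S := sig F) (Sum.inl Eff.or) ![or s₁ s₂, s₃] (0 : Fin 2) (arg s₁ s₂ i)
  have lex : ∀ (s t : Term (sig F)), RPO gt (or s₁ s₂) s → RPO gt (or (or s₁ s₂) s₃) s →
      RPO gt (or (or s₁ s₂) s₃) t → RPO gt (or (or s₁ s₂) s₃) (or s t) := by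
    intro s t h hs ht
    refine RPO.lex (S := sig F) (Sum.inl Eff.or) ![or s₁ s₂, s₃] ![s, t] (0 : Fin 2)
      (fun j hj => absurd hj (Fin.not_lt_zero j)) h fun j => ?_
    refine Fin.cases hs (fun j => ?_) j
    obtain rfl : j = 0 := Subsingleton.elim _ _
    exact ht
  -- Both the outer `or` and the inner `or s₂ s₃` are compared by their first arguments, `s₁` and
  -- `s₂`, which are proper subterms of `or s₁ s₂`.
  exact lex _ _ (arg _ _ 0) (inner 0) (lex _ _ (arg _ _ 1) (inner 1) (arg _ _ 1))

theorem or_subst (s t : Term (sig F)) (σ : ℕ → Term (sig F)) :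
    (or s t).subst σ = or (s.subst σ) (t.subst σ) :=
  congrArg (Term.sym (S := sig F) (Sum.inl Eff.or)) (subst_pair s t σ)

theorem rule_below {l r : Term (sig F)} (h : Rule l r) (e : (sig F).Eff)
    (ts : Fin ((sig F).effArity e) → Term (sig F)) (hl : l = .sym (Sum.inl e) ts) :
    Below (fun _ _ => False) e ts r := by
  obtain ⟨s₁, s₂, s₃⟩ := h
  cases hl
  have arg : ∀ i : Fin 2, Below (fun _ _ => False) (Eff.or : (sig F).Eff) ![or s₁ s₂, s₃]
      (![or s₁ s₂, s₃] i) :=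
    Below.arg (S := sig F) (e := Eff.or)
  have inner : ∀ i : Fin 2, ArgOf (![s₁, s₂] i) (or s₁ s₂) := ArgOf.mk (S := sig F) Eff.or ![s₁, s₂]
  have lex : ∀ s t, ArgOf s (or s₁ s₂) →
      Below (fun _ _ => False) (Eff.or : (sig F).Eff) ![or s₁ s₂, s₃] t →
        Below (fun _ _ => False) (Eff.or : (sig F).Eff) ![or s₁ s₂, s₃] (or s t) := by
    intro s t hs ht
    refine Below.lex (S := sig F) (e := Eff.or) ![s, t] (0 : Fin 2)
      (fun j hj => absurd hj (Fin.not_lt_zero j)) hs fun j => ?_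
    refine Fin.cases ?_ (fun j => ?_) j
    · exact .sub (arg 0) hs
    · obtain rfl : j = 0 := Subsingleton.elim _ _
      exact ht
  exact lex _ _ (inner 0) (lex _ _ (inner 1) (arg 1))

theorem effectRules : EffectRules (fun _ _ => False) (Rule (F := F)) where
  wf := ⟨fun _ => ⟨_, fun _ h => h.elim⟩⟩
  headed := by
    rintro _ _ ⟨⟩
    exact ⟨_, _, rfl⟩
  stable := by
    rintro _ _ σ ⟨s₁, s₂, s₃⟩
    simp only [or_subst]
    exact .assoc _ _ _
  below e ts _ h := rule_below h e ts rfl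

end Nondet

/-! ### Parallelism. -/

namespace Parallel

variable {B : Type u} {F : FunctionSymbols.{u, w} B} {E : Type v} {ar : E → ℕ}

theorem exists_precedence :
    ∃ gt : (sig F E ar).Symbol → (sig F E ar).Symbol → Prop,
      IsPrecedence gt ∧ ∀ e : E, gt (Sum.inl Eff.par) (Sum.inl (Eff.other e)) :=
  ⟨fun a b => a = Sum.inl Eff.par ∧ ∃ e, b = Sum.inl (Eff.other e),
    isPrecedence_twoLevel (S := sig F E ar) (P := fun a => a = Sum.inl Eff.par)
      (Q := fun b => ∃ e, b = Sum.inl (Eff.other e)) (by rintro _ rfl ⟨e, he⟩; cases he),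
    fun e => ⟨rfl, e, rfl⟩⟩

theorem containedInRPO (gt : (sig F E ar).Symbol → (sig F E ar).Symbol → Prop)
    (h : ∀ e : E, gt (Sum.inl Eff.par) (Sum.inl (Eff.other e))) :
    ContainedInRPO gt (Rule (F := F) (E := E) (ar := ar)) := by
  have arg : ∀ (s t : Term (sig F E ar)) (i : Fin 2), RPO gt (par s t) (![s, t] i) :=
    fun s t i => RPO.argEq (S := sig F E ar) (Sum.inl Eff.par) ![s, t] i
  have argOther : ∀ (e : E) (ts : Fin (ar e) → Term (sig F E ar)) (i : Fin (ar e)),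
      RPO gt (other e ts) (ts i) := fun e ts i => RPO.argEq (S := sig F E ar)
        (Sum.inl (Eff.other e)) ts i
  intro l r hlr
  cases hlr with
  | left e ss t =>
    refine RPO.prec (S := sig F E ar) (Sum.inl Eff.par) (Sum.inl (Eff.other e)) ![other e ss, t] _
      (h e) fun i => ?_
    refine RPO.lex (S := sig F E ar) (Sum.inl Eff.par) ![other e ss, t] ![ss i, t] (0 : Fin 2)
      (fun j hj => absurd hj (Fin.not_lt_zero j)) (argOther e ss i) fun j => ?_
    refine Fin.cases ?_ (fun j => ?_) j
    · exact RPO.argGt (S := sig F E ar) (Sum.inl Eff.par) ![other e ss, t] (0 : Fin 2)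
        (argOther e ss i)
    · obtain rfl : j = 0 := Subsingleton.elim _ _
      exact arg _ _ 1
  | right e s ts =>
    refine RPO.prec (S := sig F E ar) (Sum.inl Eff.par) (Sum.inl (Eff.other e)) ![s, other e ts] _
      (h e) fun i => ?_
    refine RPO.lex (S := sig F E ar) (Sum.inl Eff.par) ![s, other e ts] ![s, ts i] (1 : Fin 2)
      (fun j hj => ?_) (argOther e ts i) fun j => ?_
    · obtain rfl : j = 0 := Fin.lt_one_iff j |>.mp hj
      rfl
    refine Fin.cases ?_ (fun j => ?_) j
    · exact arg _ _ 0
    · obtain rfl : j = 0 := Subsingleton.elim _ _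
      exact RPO.argGt (S := sig F E ar) (Sum.inl Eff.par) ![s, other e ts] (1 : Fin 2)
        (argOther e ts i)

theorem par_subst (s t : Term (sig F E ar)) (σ : ℕ → Term (sig F E ar)) :
    (par s t).subst σ = par (s.subst σ) (t.subst σ) :=
  congrArg (Term.sym (S := sig F E ar) (Sum.inl Eff.par)) (subst_pair s t σ)

theorem other_subst (e : E) (ts : Fin (ar e) → Term (sig F E ar))
    (σ : ℕ → Term (sig F E ar)) :
    (other e ts).subst σ = other e fun i => (ts i).subst σ :=
  rfl

theorem rule_below {l r : Term (sig F E ar)} (h : Rule l r) (e : (sig F E ar).Eff)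
    (ts : Fin ((sig F E ar).effArity e) → Term (sig F E ar)) (hl : l = .sym (Sum.inl e) ts) :
    Below (fun a b => a = Eff.par ∧ ∃ e, b = Eff.other e) e ts r := by
  cases h with
  | left e ss t =>
    cases hl
    have arg : ∀ i : Fin 2, Below (fun a b => a = Eff.par ∧ ∃ e, b = Eff.other e)
        (Eff.par : (sig F E ar).Eff) ![other e ss, t] (![other e ss, t] i) :=
      Below.arg (S := sig F E ar) (e := Eff.par)
    refine Below.prec (S := sig F E ar) (Eff.other e) _ ⟨rfl, e, rfl⟩ fun i => ?_
    have ha : ArgOf (ss i) (other e ss) := ArgOf.mk (S := sig F E ar) (Eff.other e) ss i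
    refine Below.lex (S := sig F E ar) (e := Eff.par) ![ss i, t] (0 : Fin 2)
      (fun j hj => absurd hj (Fin.not_lt_zero j)) ha fun j => ?_
    refine Fin.cases ?_ (fun j => ?_) j
    · exact .sub (arg 0) ha
    · obtain rfl : j = 0 := Subsingleton.elim _ _
      exact arg 1
  | right e s ts =>
    cases hl
    have arg : ∀ i : Fin 2, Below (fun a b => a = Eff.par ∧ ∃ e, b = Eff.other e)
        (Eff.par : (sig F E ar).Eff) ![s, other e ts] (![s, other e ts] i) :=
      Below.arg (S := sig F E ar) (e := Eff.par)
    refine Below.prec (S := sig F E ar) (Eff.other e) _ ⟨rfl, e, rfl⟩ fun i => ?_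
    have ha : ArgOf (ts i) (other e ts) := ArgOf.mk (S := sig F E ar) (Eff.other e) ts i
    -- In the right-hand rule the first arguments agree, so the second position decides.
    refine Below.lex (S := sig F E ar) (e := Eff.par) ![s, ts i] (1 : Fin 2) (fun j hj => ?_) ha
      fun j => ?_
    · obtain rfl : j = 0 := Fin.lt_one_iff j |>.mp hj
      rfl
    refine Fin.cases ?_ (fun j => ?_) j
    · exact arg 0
    · obtain rfl : j = 0 := Subsingleton.elim _ _
      exact .sub (arg 1) ha

theorem effectRules :
    EffectRules (fun a b => a = Eff.par ∧ ∃ e, b = Eff.other e)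
      (Rule (F := F) (E := E) (ar := ar)) where
  wf := wellFounded_twoLevel (by rintro _ rfl ⟨e, he⟩; cases he)
  headed := by
    rintro _ _ (_ | _) <;> exact ⟨_, _, rfl⟩
  stable := by
    rintro _ _ σ (⟨e, ss, t⟩ | ⟨e, s, ts⟩)
    · simp only [par_subst, other_subst]
      exact .left e _ _
    · simp only [par_subst, other_subst]
      exact .right e _ _
  below e ts _ h := rule_below h e ts rfl

end Parallel

/-! ### Request-retry. -/

namespace RequestRetry

variable {B : Type u} {F : FunctionSymbols.{u, w} B} {n : ℕ}

theorem exists_precedence :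
    ∃ gt : (sig F n).Symbol → (sig F n).Symbol → Prop,
      IsPrecedence gt ∧ gt (Sum.inl Eff.retry) (Sum.inl Eff.request) :=
  ⟨fun a b => a = Sum.inl Eff.retry ∧ b = Sum.inl Eff.request,
    isPrecedence_twoLevel (S := sig F n) (P := fun a => a = Sum.inl Eff.retry)
      (Q := fun b => b = Sum.inl Eff.request) (by rintro _ rfl ⟨⟩), rfl, rfl⟩

theorem containedInRPO (gt : (sig F n).Symbol → (sig F n).Symbol → Prop)
    (h : gt (Sum.inl Eff.retry) (Sum.inl Eff.request)) :
    ContainedInRPO gt (Rule (F := F) (n := n)) := by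
  have arg : ∀ (u t : Term (sig F n)) (ss : Fin n → Term (sig F n)) (i : Fin (n + 1)),
      RPO gt (retry u (request t ss)) ((Fin.cons t ss : Fin (n + 1) → Term (sig F n)) i) :=
    fun u t ss i => RPO.argGt (S := sig F n) (Sum.inl Eff.retry) ![u, request t ss] (1 : Fin 2)
      (RPO.argEq (S := sig F n) (Sum.inl Eff.request)
        (Fin.cons t ss : Fin (n + 1) → Term (sig F n)) i)
  intro l r hlr
  cases hlr with
  | retryZero _ ss => exact arg zero r ss 0
  | retrySucc u t ss =>
    have hu : RPO gt (succ u) u := RPO.argEq (S := sig F n) (Sum.inl Eff.succ) ![u] (0 : Fin 1)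
    refine RPO.prec (S := sig F n) (Sum.inl Eff.retry) (Sum.inl Eff.request)
      ![succ u, request t ss] _ h fun i => ?_
    refine Fin.cases ?_ (fun i => arg (succ u) t ss i.succ) i
    refine RPO.lex (S := sig F n) (Sum.inl Eff.retry) ![succ u, request t ss] ![u, request t ss]
      (0 : Fin 2)
      (fun j hj => absurd hj (Fin.not_lt_zero j)) hu fun j => ?_
    refine Fin.cases ?_ (fun j => ?_) j
    · exact RPO.argGt (S := sig F n) (Sum.inl Eff.retry) ![succ u, request t ss] (0 : Fin 2) hu
    · obtain rfl : j = 0 := Subsingleton.elim _ _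
      exact RPO.argEq (S := sig F n) (Sum.inl Eff.retry) ![succ u, request t ss] (1 : Fin 2)

theorem zero_subst (σ : ℕ → Term (sig F n)) : (zero : Term (sig F n)).subst σ = zero :=
  congrArg (Term.sym (S := sig F n) (Sum.inl Eff.zero)) (funext fun i => Fin.elim0 i)

theorem succ_subst (u : Term (sig F n)) (σ : ℕ → Term (sig F n)) :
    (succ u).subst σ = succ (u.subst σ) :=
  congrArg (Term.sym (S := sig F n) (Sum.inl Eff.succ))
    (funext fun i : Fin 1 => by obtain rfl : i = 0 := Subsingleton.elim _ _; rfl)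

theorem retry_subst (u r : Term (sig F n)) (σ : ℕ → Term (sig F n)) :
    (retry u r).subst σ = retry (u.subst σ) (r.subst σ) :=
  congrArg (Term.sym (S := sig F n) (Sum.inl Eff.retry)) (subst_pair u r σ)

theorem request_subst (t : Term (sig F n)) (ss : Fin n → Term (sig F n))
    (σ : ℕ → Term (sig F n)) :
    (request t ss).subst σ = request (t.subst σ) fun i => (ss i).subst σ :=
  congrArg (Term.sym (S := sig F n) (Sum.inl Eff.request))
    (funext fun i : Fin (n + 1) => Fin.cases rfl (fun _ => rfl) i)

theorem rule_below {l r : Term (sig F n)} (h : Rule l r) (e : (sig F n).Eff)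
    (ts : Fin ((sig F n).effArity e) → Term (sig F n)) (hl : l = .sym (Sum.inl e) ts) :
    Below (fun a b => a = Eff.retry ∧ b = Eff.request) e ts r := by
  have ha : ∀ (t : Term (sig F n)) (ss : Fin n → Term (sig F n)) (i : Fin (n + 1)),
      ArgOf ((Fin.cons t ss : Fin (n + 1) → Term (sig F n)) i) (request t ss) :=
    fun t ss i => ArgOf.mk (S := sig F n) Eff.request
      (Fin.cons t ss : Fin (n + 1) → Term (sig F n)) i
  cases h with
  | retryZero _ ss =>
    cases hl
    have arg : ∀ i : Fin 2, Below (fun a b => a = Eff.retry ∧ b = Eff.request)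
        (Eff.retry : (sig F n).Eff) ![zero, request r ss] (![zero, request r ss] i) :=
      Below.arg (S := sig F n) (e := Eff.retry)
    exact .sub (arg 1) (ha r ss 0)
  | retrySucc u t ss =>
    cases hl
    have arg : ∀ i : Fin 2, Below (fun a b => a = Eff.retry ∧ b = Eff.request)
        (Eff.retry : (sig F n).Eff) ![succ u, request t ss] (![succ u, request t ss] i) :=
      Below.arg (S := sig F n) (e := Eff.retry)
    have hu : ArgOf u (succ u) := ArgOf.mk (S := sig F n) Eff.succ ![u] (0 : Fin 1)
    refine Below.prec (S := sig F n) Eff.request _ ⟨rfl, rfl⟩ fun i => ?_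
    -- The success branches are arguments of the old request; only the failure branch contains a new
    -- `retry`, whose counter has dropped from `succ u` to `u`.
    refine Fin.cases ?_ (fun i => .sub (arg 1) (ha t ss i.succ)) i
    refine Below.lex (S := sig F n) (e := Eff.retry) ![u, request t ss] (0 : Fin 2)
      (fun j hj => absurd hj (Fin.not_lt_zero j)) hu fun j => ?_
    refine Fin.cases ?_ (fun j => ?_) j
    · exact .sub (arg 0) hu
    · obtain rfl : j = 0 := Subsingleton.elim _ _
      exact arg 1

theorem effectRules :
    EffectRules (fun a b => a = Eff.retry ∧ b = Eff.request) (Rule (F := F) (n := n)) where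
  wf := wellFounded_twoLevel (by rintro _ rfl ⟨⟩)
  headed := by
    rintro _ _ (_ | _) <;> exact ⟨_, _, rfl⟩
  stable := by
    rintro _ _ σ (⟨t, ss⟩ | ⟨u, t, ss⟩)
    · simp only [retry_subst, request_subst, zero_subst]
      exact .retryZero _ _
    · simp only [retry_subst, request_subst, succ_subst]
      exact .retrySucc _ _ _
  below e ts _ h := rule_below h e ts rfl

end RequestRetry
end AlgEff

theorem mainTheorem4 {B : Type u} (F : FunctionSymbols.{u, w} B) :
    -- Global state
    (∀ n : ℕ,
      (∀ gt : (GlobalState.sig F n).Symbol → (GlobalState.sig F n).Symbol → Prop,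
        IsPrecedence gt → ContainedInRPO gt (GlobalState.Rule (F := F) (n := n))) ∧
      TypedSN (GlobalState.Rule (F := F) (n := n)) ∧
      (∀ (Γ : List (Ty B)) (t : Term (GlobalState.sig F n)) (T : Ty B),
        HasType Γ t (.comp T) → GlobalState.IsTrace t →
          (∃ t', Relation.ReflTransGen (Step GlobalState.Rule) t t' ∧
            IsNormal (Step GlobalState.Rule) t') ∧
          (∀ t', Relation.ReflTransGen (Step GlobalState.Rule) t t' →
            IsNormal (Step GlobalState.Rule) t' → GlobalState.IsState t'))) ∧
    -- Nondeterminism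
    ((∀ gt : (Nondet.sig F).Symbol → (Nondet.sig F).Symbol → Prop,
        IsPrecedence gt → ContainedInRPO gt (Nondet.Rule (F := F))) ∧
      TypedSN (Nondet.Rule (F := F))) ∧
    -- Parallelism
    (∀ (E : Type v) (ar : E → ℕ),
      (∃ gt : (Parallel.sig F E ar).Symbol → (Parallel.sig F E ar).Symbol → Prop,
        IsPrecedence gt ∧ ∀ e : E, gt (Sum.inl Parallel.Eff.par) (Sum.inl (Parallel.Eff.other e))) ∧
      (∀ gt : (Parallel.sig F E ar).Symbol → (Parallel.sig F E ar).Symbol → Prop,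
        IsPrecedence gt →
        (∀ e : E, gt (Sum.inl Parallel.Eff.par) (Sum.inl (Parallel.Eff.other e))) →
          ContainedInRPO gt (Parallel.Rule (F := F) (E := E) (ar := ar))) ∧
      TypedSN (Parallel.Rule (F := F) (E := E) (ar := ar))) ∧
    -- Request-retry
    (∀ n : ℕ,
      (∃ gt : (RequestRetry.sig F n).Symbol → (RequestRetry.sig F n).Symbol → Prop,
        IsPrecedence gt ∧ gt (Sum.inl RequestRetry.Eff.retry) (Sum.inl RequestRetry.Eff.request)) ∧
      (∀ gt : (RequestRetry.sig F n).Symbol → (RequestRetry.sig F n).Symbol → Prop,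
        IsPrecedence gt →
        gt (Sum.inl RequestRetry.Eff.retry) (Sum.inl RequestRetry.Eff.request) →
          ContainedInRPO gt (RequestRetry.Rule (F := F) (n := n))) ∧
      TypedSN (RequestRetry.Rule (F := F) (n := n))) := by
  refine ⟨fun n => ⟨fun gt _ => GlobalState.containedInRPO gt, GlobalState.effectRules.typedSN,
    fun Γ t T h ht => ⟨(GlobalState.effectRules.typedSN Γ t _ h).exists_normal,
      fun t' ht' hn => (ht.reduces ht').isState hn⟩⟩,
    ⟨fun gt _ => Nondet.containedInRPO gt, Nondet.effectRules.typedSN⟩,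
    fun E ar => ⟨Parallel.exists_precedence, fun gt _ h => Parallel.containedInRPO gt h,
      Parallel.effectRules.typedSN⟩,
    fun n => ⟨RequestRetry.exists_precedence, fun gt _ h => RequestRetry.containedInRPO gt h,
      RequestRetry.effectRules.typedSN⟩⟩
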